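/- Let $\Gamma$ be a word-hyperbolic group acting isometrically, properly discontinuously and convex cocompactly on a proper $\mathrm{CAT}(-1)$ space $(X,d)$, where convex cocompact means that there is a nonempty $\Gamma$-invariant quasiconvex (for instance, convex) subset of $X$ on which $\Gamma$ acts cocompactly; equivalently, orbit maps $\Gamma\to X$ are quasi-isometric embeddings for the word metric. Let $x_0\in X$, let $g\in\Gamma$, and let $Z(g)=\{h\in\Gamma: hg=gh\}$. Let $\Gamma_0=\{\overline 1,\dots,\overline n\}$ be a finite symmetric generating set of $\Gamma$ with $n$ elements, let $S=\{1,\dots,n\}$, and for a word $w=w_1\cdots w_k$ over $S$ write $\overline w=\overline{w_1}\cdots\overline{w_k}\in\Gamma$; the word $w$ is geodesic if no shorter word represents $\overline w$. Let $(\mathcal G,*,\lambda)$ be a Redfern coding for $Z(g)$, that is: $\mathcal G$ is a finite directed graph with vertex set $V$ and edge set $E\subset V\times V$, $*\in V$ is a vertex at which no edge ends, and $\lambda:E\to S$ is a labelling such that, with $\mathfrak L(\mathcal G)$ the set of finite paths $x=(v_0,v_1,\dots,v_p)$, $p\ge 0$, $v_0=*$, in $\mathcal G$ starting at $*$, and $\lambda(x)=\lambda(v_0,v_1)\cdots\lambda(v_{p-1},v_p)$: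 every $\lambda(x)$ with $x\in\mathfrak L(\mathcal G)$ is a geodesic word; the map $\mathfrak L(\mathcal G)\to Z(g)\backslash\Gamma$, $x\mapsto Z(g)\overline{\lambda(x)}$, is bijective; and every vertex is the endpoint of some path in $\mathfrak L(\mathcal G)$. For $x=(v_0,\dots,v_p)\in\mathfrak L(\mathcal G)$ let $|x|=p+1$ and $L_x=d(\overline{\lambda(x)}\cdot x_0,x_0)$, and for $u\in\mathfrak L(\mathcal G)$ let $\mathcal J(u)$ be the set of $x\in\mathfrak L(\mathcal G)$ with $|x|\ge|u|$ whose first $|u|$ vertices form $u$. Let $\langle y,z\rangle_w=\frac12(d(w,y)+d(w,z)-d(y,z))$ be the Gromov product on $X$, and set \[\tau(u)=d(g\cdot x_0,x_0)-2\left\langle \overline{\lambda(u)}\cdot x_0,\,g\overline{\lambda(u)}\cdot x_0\right\rangle_{g\cdot x_0}-2\left\langle g\cdot x_0,\,\overline{\lambda(u)}\cdot x_0\right\rangle_{x_0}.\] Then $\tau$ is bounded on $\mathfrak L(\mathcal G)$, and there exist constants $K>0$ and $0<\rho<1$ such that for every $l\in\mathbb N$, every $u\in\mathfrak L(\mathcal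 G)$ with $|u|=l$ and every $x\in\mathcal J(u)$, \[\left|d\left(\overline{\lambda(x)}^{-1}g\,\overline{\lambda(x)}\cdot x_0,\,x_0\right)-2L_x-\tau(u)\right|\le K\rho^l.\] -/

import Mathlib

namespace RedfernCoding

open scoped UpperHalfPlane Pointwise

/-! ### Metric geometry -/

/-- The Gromov product `⟨y, z⟩_x` in a metric space. -/
noncomputable def gromovProduct {Y : Type*} [MetricSpace Y] (y z x : Y) : ℝ :=
  (dist x y + dist x z - dist y z) / 2

/-- `γ`, restricted to `[0, dist x y]`, is a geodesic segment from `x` to `y`. -/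
def IsGeodesicSegment {Y : Type*} [MetricSpace Y] (x y : Y) (γ : ℝ → Y) : Prop :=
  γ 0 = x ∧ γ (dist x y) = y ∧
    ∀ s ∈ Set.Icc 0 (dist x y), ∀ t ∈ Set.Icc 0 (dist x y), dist (γ s) (γ t) = |s - t|

/-- Any two points are joined by a geodesic segment. -/
def IsGeodesicSpace (Y : Type*) [MetricSpace Y] : Prop :=
  ∀ x y : Y, ∃ γ : ℝ → Y, IsGeodesicSegment x y γ

/-- A `CAT(-1)` space: a geodesic space whose geodesic triangles are no fatter than their
comparison triangles in the hyperbolic plane `ℍ`. Two points of a triangle either lie on one side,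
where the comparison map is an isometry, or on two sides that share a vertex, here called `x`. -/
def IsCATNegOne (Y : Type*) [MetricSpace Y] : Prop :=
  IsGeodesicSpace Y ∧
    ∀ (x y z : Y) (p q : ℝ → Y), IsGeodesicSegment x y p → IsGeodesicSegment x z q →
      ∃ (x' y' z' : ℍ) (p' q' : ℝ → ℍ),
        dist x' y' = dist x y ∧ dist y' z' = dist y z ∧ dist x' z' = dist x z ∧
        IsGeodesicSegment x' y' p' ∧ IsGeodesicSegment x' z' q' ∧
        ∀ s ∈ Set.Icc 0 (dist x y), ∀ t ∈ Set.Icc 0 (dist x z),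
          dist (p s) (q t) ≤ dist (p' s) (q' t)

/-- A subset is quasiconvex if, for some `R`, every geodesic segment with endpoints in it stays
within distance `R` of it. -/
def IsQuasiconvex {Y : Type*} [MetricSpace Y] (C : Set Y) : Prop :=
  ∃ R : ℝ, ∀ a ∈ C, ∀ b ∈ C, ∀ γ : ℝ → Y, IsGeodesicSegment a b γ →
    ∀ t ∈ Set.Icc 0 (dist a b), ∃ c ∈ C, dist (γ t) c ≤ R

/-- Convex cocompactness, in the coarse form usual for hyperbolic spaces: there is a nonempty
invariant quasiconvex subset on which the group acts cocompactly. A nonempty invariant convex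
subset with compact quotient is a special case (`R = 0`); so is, by stability of quasi-geodesics,
any orbit of an action whose orbit map is a quasi-isometric embedding for the word metric. -/
def IsConvexCocompact (Γ X : Type*) [Group Γ] [MetricSpace X] [MulAction Γ X] : Prop :=
  ∃ C : Set X, C.Nonempty ∧ (∀ h : Γ, h • C = C) ∧ IsQuasiconvex C ∧
    ∃ K : Set X, K ⊆ C ∧ IsCompact K ∧ C ⊆ ⋃ h : Γ, h • K

/-! ### Words and the word metric -/

section Words

variable {Γ : Type*} [Group Γ] {n : ℕ}

/-- `gen` enumerates, without repetition, a finite symmetric set that generates `Γ`. -/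
def IsSymmetricGenerating (gen : Fin n → Γ) : Prop :=
  Function.Injective gen ∧ (∀ i, (gen i)⁻¹ ∈ Set.range gen) ∧
    Subgroup.closure (Set.range gen) = ⊤

/-- The group element represented by a word. -/
def wordEval (gen : Fin n → Γ) (w : List (Fin n)) : Γ := (w.map gen).prod

/-- The word length of a group element. -/
noncomputable def wordLength (gen : Fin n → Γ) (h : Γ) : ℕ :=
  sInf {k | ∃ w : List (Fin n), w.length = k ∧ wordEval gen w = h}

/-- The word metric. -/
noncomputable def wordDist (gen : Fin n → Γ) (a b : Γ) : ℝ := wordLength gen (a⁻¹ * b)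

/-- A word is geodesic if it is a shortest word for the element it represents. -/
def IsGeodesicWord (gen : Fin n → Γ) (w : List (Fin n)) : Prop :=
  w.length = wordLength gen (wordEval gen w)

end Words

/-- `Γ` is word-hyperbolic: for some finite symmetric generating set, the word metric satisfies
Gromov's four-point inequality. -/
def IsWordHyperbolic (Γ : Type*) [Group Γ] : Prop :=
  ∃ (n : ℕ) (gen : Fin n → Γ), IsSymmetricGenerating gen ∧ ∃ δ : ℝ, ∀ a b c d : Γ,
    wordDist gen a b + wordDist gen c d ≤
      max (wordDist gen a c + wordDist gen b d) (wordDist gen a d + wordDist gen b c) + 2 * δ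

/-! ### Labelled graphs and codings -/

/-- A directed graph on `V` with a distinguished vertex at which no edge ends, and with edges
labelled by `Fin n`. -/
structure LabelledGraph (V : Type*) (n : ℕ) where
  edges : Set (V × V)
  star : V
  not_mem_edges_star : ∀ v, (v, star) ∉ edges
  label : edges → Fin n

namespace LabelledGraph

variable {V : Type*} {n : ℕ} (G : LabelledGraph V n)

/-- `x` is the vertex sequence of a path. -/
def IsWalk (x : List V) : Prop := x.IsChain (fun a b => (a, b) ∈ G.edges)

/-- The word read along a path. -/
def labelWord : (x : List V) → G.IsWalk x → List (Fin n)
  | [], _ => []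
  | [_], _ => []
  | _ :: b :: l, h =>
      G.label ⟨_, (List.isChain_cons_cons.1 h).1⟩ ::
        labelWord (b :: l) (List.isChain_cons_cons.1 h).2

/-- The set of paths that start at the distinguished vertex (the one-vertex path included). -/
def Path : Type _ := {x : List V // x.head? = some G.star ∧ G.IsWalk x}

variable {G}

/-- The word `λ(x)` of a path `x`. -/
def Path.word (x : G.Path) : List (Fin n) := G.labelWord x.1 x.2.2

/-- The length `|x|` of a path: its number of vertices. -/
def Path.length (x : G.Path) : ℕ := x.1.length

/-- The set `𝒥(u)` of paths whose first `|u|` vertices form `u`. -/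
def Path.extensions (u : G.Path) : Set G.Path := {x | u.1 <+: x.1}

/-- The group element represented by the word of a path. -/
def Path.elt {Γ : Type*} [Group Γ] (gen : Fin n → Γ) (x : G.Path) : Γ := wordEval gen x.word

variable (G)

/-- `G` is a Redfern coding for the right cosets of `H`: every path from the distinguished vertex
reads a geodesic word, every right coset `H a` is represented by exactly one such path, and every
vertex is reached by such a path. -/
structure IsRedfernCoding {Γ : Type*} [Group Γ] (gen : Fin n → Γ) (H : Subgroup Γ) : Prop where
  geodesic : ∀ x : G.Path, IsGeodesicWord gen x.word
  bijective : Function.Bijective fun x : G.Path =>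
    (Quotient.mk (QuotientGroup.rightRel H) (x.elt gen))
  accessible : ∀ v : V, ∃ x : G.Path, x.1.getLast? = some v

end LabelledGraph

section Displacement

variable {Γ X V : Type*} [Group Γ] [MetricSpace X] [MulAction Γ X] {n : ℕ}
  {G : LabelledGraph V n}

/-- The displacement `L_x` of a path. -/
noncomputable def displacement (gen : Fin n → Γ) (x₀ : X) (x : G.Path) : ℝ :=
  dist (x.elt gen • x₀) x₀

/-- The correction term `τ(u)`. -/
noncomputable def tau (gen : Fin n → Γ) (x₀ : X) (g : Γ) (u : G.Path) : ℝ :=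
  dist (g • x₀) x₀
    - 2 * gromovProduct (u.elt gen • x₀) ((g * u.elt gen) • x₀) (g • x₀)
    - 2 * gromovProduct (g • x₀) (u.elt gen • x₀) x₀

end Displacement

end RedfernCoding

namespace RedfernCoding

open scoped UpperHalfPlane Pointwise

/-! ### Triangles in the hyperbolic plane -/

/-! Write `F p = d(p, g p) - 2 d(p, x₀)`. The quantity compared with `τ(u)` is `F` at the orbit
point of `x`, and `τ(u)` is `F` at the orbit point of the prefix `u` (`tau_eq`). It is therefore
enough that `F` changes by `O(ρ ^ j)` at the `j`-th letter of the word and that these changes sum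
geometrically (`abs_sub_le_of_geometric_increments`).

One letter moves `p` a bounded distance to `q`, and `F p - F q` splits into two cross differences of
distances. In a `CAT(-1)` space each is exponentially small in a Gromov product based at the moving
point (`abs_cross_difference_le`). That product is at least `d(q, x₀)` minus a constant, provided
`⟨p, g p⟩` and `⟨q, g q⟩` based at `x₀` are bounded (`abs_excess_sub_le`). Since the action is
convex cocompact, `d(q, x₀)` grows linearly along geodesic words
(`IsConvexCocompact.exists_wordLength_le`).

The uniform bound on `⟨p, g p⟩` (`exists_gromovProduct_smul_le`) is where the coding enters.
Prefixes of a path lie in distinct cosets of `Z(g)`, so they conjugate `g` to distinct elements. If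
the product were large, `g` would move a long initial piece of `[x₀, p]` a bounded amount. By
stability of quasi-geodesics many prefixes pass near that piece, and their conjugates of `g` would
all lie in one finite set: a contradiction by pigeonhole. -/

/-- In the quadratic space with form `A C - B ^ 2`, a null vector orthogonal to a unit vector
vanishes. -/
lemma null_vector_eq_zero {A B C α β γ : ℝ} (hM : A * C = B ^ 2 + 1) (hN : α * γ = β ^ 2)
    (hO : A * γ + C * α - 2 * (B * β) = 0) : α = 0 ∧ β = 0 ∧ γ = 0 := by
  -- The orthogonal complement of a unit vector is definite: using orthogonality to eliminate `γ`,
  -- the null form becomes a sum of squares.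
  have h1 : (A * β - B * α) ^ 2 + α ^ 2 = 0 := by
    linear_combination A * α * hO - A ^ 2 * hN - α ^ 2 * hM
  have hα : α = 0 := by nlinarith [sq_nonneg (A * β - B * α), sq_nonneg α]
  have hA : A ≠ 0 := by
    rintro rfl
    nlinarith [sq_nonneg B]
  subst hα
  have hβ : β = 0 := by
    have : β ^ 2 = 0 := by linarith
    exact pow_eq_zero_iff (two_ne_zero) |>.1 this
  subst hβ
  refine ⟨rfl, rfl, ?_⟩
  have : A * γ = 0 := by linarith
  exact (mul_eq_zero.1 this).resolve_left hA

/-- `cosh (dist z w)` as a bilinear form in the coordinates `(1 / y, x / y, (x² + y²) / y)`. -/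
lemma cosh_dist_eq_form (z w : ℍ) : Real.cosh (dist z w) =
    ((1 / z.im) * ((w.re ^ 2 + w.im ^ 2) / w.im) + ((z.re ^ 2 + z.im ^ 2) / z.im) * (1 / w.im)
      - 2 * ((z.re / z.im) * (w.re / w.im))) / 2 := by
  have hz := z.im_pos.ne'
  have hw := w.im_pos.ne'
  rw [UpperHalfPlane.cosh_dist']
  field_simp
  ring

/-- The hyperbolic Stewart theorem. -/
lemma stewart {x y m w : ℍ} {a s : ℝ} (ha : 0 < a) (hxy : dist x y = a)
    (hxm : dist x m = s) (hmy : dist m y = a - s) :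
    Real.sinh a * Real.cosh (dist w m) =
      Real.sinh (a - s) * Real.cosh (dist w x) + Real.sinh s * Real.cosh (dist w y) := by
  have hS : Real.sinh a ≠ 0 := (Real.sinh_pos_iff.2 ha).ne'
  have e1 := cosh_dist_eq_form x y
  have e2 := cosh_dist_eq_form x m
  have e3 := cosh_dist_eq_form m y
  have ex := cosh_dist_eq_form x x
  have ey := cosh_dist_eq_form y y
  have em := cosh_dist_eq_form m m
  rw [cosh_dist_eq_form w m, cosh_dist_eq_form w x, cosh_dist_eq_form w y]
  rw [hxy] at e1
  rw [hxm] at e2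
  rw [hmy] at e3
  rw [dist_self, Real.cosh_zero] at ex ey em
  have ca : Real.cosh a = Real.cosh s * Real.cosh (a - s) + Real.sinh s * Real.sinh (a - s) := by
    rw [← Real.cosh_add]; congr 1; ring
  have sa : Real.sinh a = Real.sinh s * Real.cosh (a - s) + Real.cosh s * Real.sinh (a - s) := by
    rw [← Real.sinh_add]; congr 1; ring
  have cs := Real.cosh_sq s
  have cs' := Real.cosh_sq (a - s)
  generalize Real.sinh a = Sa at *
  generalize Real.cosh a = Ca at *
  generalize Real.sinh (a - s) = S' at *
  generalize Real.cosh (a - s) = C' at *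
  generalize Real.sinh s = S at *
  generalize Real.cosh s = C at *
  generalize 1 / x.im = x1 at *
  generalize x.re / x.im = x2 at *
  generalize (x.re ^ 2 + x.im ^ 2) / x.im = x3 at *
  generalize 1 / y.im = y1 at *
  generalize y.re / y.im = y2 at *
  generalize (y.re ^ 2 + y.im ^ 2) / y.im = y3 at *
  generalize 1 / m.im = m1 at *
  generalize m.re / m.im = m2 at *
  generalize (m.re ^ 2 + m.im ^ 2) / m.im = m3 at *
  subst ca sa
  -- In hyperboloid coordinates, `sinh (a - s) x + sinh s y - sinh a m` is null and orthogonal to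
  -- `m`, hence zero. Pairing it with `w` gives the formula.
  obtain ⟨h1, h2, h3⟩ := null_vector_eq_zero (A := m1) (B := m2) (C := m3)
    (α := S' * x1 + S * y1 - (S * C' + C * S') * m1)
    (β := S' * x2 + S * y2 - (S * C' + C * S') * m2)
    (γ := S' * x3 + S * y3 - (S * C' + C * S') * m3) (by linarith)
    (by
      linear_combination (-S' ^ 2) * ex - S ^ 2 * ey - (S * C' + C * S') ^ 2 * em
        - 2 * S' * S * e1 + 2 * S' * (S * C' + C * S') * e2 + 2 * S * (S * C' + C * S') * e3
        - S ^ 2 * cs' - S' ^ 2 * cs)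
    (by linear_combination (-2 * S') * e2 - 2 * S * e3 + 2 * (S * C' + C * S') * em)
  linear_combination (-(w.re ^ 2 + w.im ^ 2) / w.im / 2) * h1 + w.re / w.im * h2
    - (1 / w.im) / 2 * h3


lemma IsGeodesicSegment.dist_left {Y : Type*} [MetricSpace Y] {x y : Y} {γ : ℝ → Y}
    (h : IsGeodesicSegment x y γ) {s : ℝ} (hs : s ∈ Set.Icc 0 (dist x y)) :
    dist x (γ s) = s := by
  have := h.2.2 0 ⟨le_rfl, dist_nonneg⟩ s hs
  rwa [h.1, zero_sub, abs_neg, abs_of_nonneg hs.1] at this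

lemma IsGeodesicSegment.dist_right {Y : Type*} [MetricSpace Y] {x y : Y} {γ : ℝ → Y}
    (h : IsGeodesicSegment x y γ) {s : ℝ} (hs : s ∈ Set.Icc 0 (dist x y)) :
    dist (γ s) y = dist x y - s := by
  have := h.2.2 s hs (dist x y) ⟨dist_nonneg, le_rfl⟩
  rwa [h.2.1, abs_sub_comm, abs_of_nonneg (sub_nonneg.2 hs.2)] at this

lemma gromovProduct_nonneg {Y : Type*} [MetricSpace Y] (y z x : Y) :
    0 ≤ gromovProduct y z x := by
  have := dist_triangle_left y z x
  unfold gromovProduct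
  linarith

lemma gromovProduct_comm {Y : Type*} [MetricSpace Y] (y z x : Y) :
    gromovProduct y z x = gromovProduct z y x := by
  unfold gromovProduct
  rw [dist_comm y z]
  ring

lemma gromovProduct_le_left {Y : Type*} [MetricSpace Y] (y z x : Y) :
    gromovProduct y z x ≤ dist x y := by
  have := dist_triangle x y z
  unfold gromovProduct
  linarith

lemma gromovProduct_le_right {Y : Type*} [MetricSpace Y] (y z x : Y) :
    gromovProduct y z x ≤ dist x z :=
  gromovProduct_comm y z x ▸ gromovProduct_le_left z y x

/-- In the hyperbolic plane, two geodesics issuing from a common point separate exponentially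
slowly before their Gromov product. -/
lemma dist_le_exp_upperHalfPlane {x y z : ℍ} {p q : ℝ → ℍ} (hp : IsGeodesicSegment x y p)
    (hq : IsGeodesicSegment x z q) {s : ℝ} (h0 : 0 ≤ s) (hsy : s ≤ dist x y)
    (hsz : s ≤ dist x z) : dist (p s) (q s) ≤ Real.exp (s - gromovProduct y z x) := by
  rcases h0.eq_or_lt with rfl | h0
  · rw [hp.1, hq.1, dist_self]
    positivity
  have ha : 0 < dist x y := h0.trans_le hsy
  have hb : 0 < dist x z := h0.trans_le hsz
  set T := gromovProduct y z x with hT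
  have hT0 : 0 ≤ T := gromovProduct_nonneg y z x
  have hTa : T ≤ dist x y := gromovProduct_le_left y z x
  have hTb : T ≤ dist x z := gromovProduct_le_right y z x
  -- Stewart is applied twice, to `q s` against `[x, y]` and to `y` against `[x, z]`. This expresses
  -- `cosh (dist (p s) (q s))` through the sides of the triangle alone.
  have e1 := stewart (w := q s) ha rfl (hp.dist_left ⟨h0.le, hsy⟩) (hp.dist_right ⟨h0.le, hsy⟩)
  have e2 := stewart (w := y) hb rfl (hq.dist_left ⟨h0.le, hsz⟩) (hq.dist_right ⟨h0.le, hsz⟩)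
  rw [dist_comm (q s) x, hq.dist_left ⟨h0.le, hsz⟩, dist_comm (q s) y, dist_comm (q s)] at e1
  rw [dist_comm y x] at e2
  have hc : Real.cosh (dist y z) - Real.cosh (dist x y - dist x z) =
      2 * (Real.sinh (dist x y - T) * Real.sinh (dist x z - T)) := by
    have h1 : dist y z = (dist x y - T) + (dist x z - T) := by
      rw [hT]; unfold gromovProduct; ring
    have h2 : dist x y - dist x z = (dist x y - T) - (dist x z - T) := by ring
    have k1 := Real.cosh_add (dist x y - T) (dist x z - T)
    have k2 := Real.cosh_sub (dist x y - T) (dist x z - T)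
    rw [← h1] at k1
    rw [← h2] at k2
    linarith
  have hsinh : ∀ a : ℝ, Real.sinh (a - T) ≤ Real.exp (-T) * Real.sinh a := fun a => by
    rw [Real.sinh_eq, Real.sinh_eq, show a - T = -T + a by ring, show -(-T + a) = T + -a by ring,
      Real.exp_add, Real.exp_add]
    have : Real.exp (-T) * Real.exp (-a) ≤ Real.exp T * Real.exp (-a) :=
      mul_le_mul_of_nonneg_right (Real.exp_le_exp.2 (by linarith)) (Real.exp_pos _).le
    linarith
  have hSa := Real.sinh_pos_iff.2 ha
  have hSb := Real.sinh_pos_iff.2 hb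
  have hprod : Real.sinh (dist x y - T) * Real.sinh (dist x z - T) ≤
      (Real.exp (-T) * Real.sinh (dist x y)) * (Real.exp (-T) * Real.sinh (dist x z)) :=
    mul_le_mul (hsinh _) (hsinh _) (Real.sinh_nonneg_iff.2 (by linarith)) (by positivity)
  have key : Real.cosh (dist (p s) (q s)) ≤ 1 + 2 * (Real.sinh s * Real.exp (-T)) ^ 2 := by
    rw [Real.sinh_sub] at e1 e2
    rw [Real.cosh_sub] at hc
    have hcs := Real.cosh_sq s
    have hpos : 0 < Real.sinh (dist x y) * Real.sinh (dist x z) := by positivity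
    refine le_of_mul_le_mul_left ?_ hpos
    have : Real.sinh (dist x y) * Real.sinh (dist x z) * Real.cosh (dist (p s) (q s)) =
        Real.sinh (dist x y) * Real.sinh (dist x z) + Real.sinh s ^ 2 *
          (2 * (Real.sinh (dist x y - T) * Real.sinh (dist x z - T))) := by
      rw [← hc]
      linear_combination Real.sinh (dist x z) * e1 + Real.sinh s * e2
        + Real.sinh (dist x y) * Real.sinh (dist x z) * hcs
    rw [this]
    nlinarith [mul_le_mul_of_nonneg_left hprod (sq_nonneg (Real.sinh s))]
  have hcosh : 1 + dist (p s) (q s) ^ 2 / 2 ≤ Real.cosh (dist (p s) (q s)) := by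
    rw [show dist (p s) (q s) = 2 * (dist (p s) (q s) / 2) by ring, Real.cosh_two_mul,
      Real.cosh_sq]
    have h := Real.self_le_sinh_iff.2 (show 0 ≤ dist (p s) (q s) / 2 by positivity)
    have := pow_le_pow_left₀ (show 0 ≤ dist (p s) (q s) / 2 by positivity) h 2
    nlinarith
  have hsq : dist (p s) (q s) ^ 2 ≤ (2 * (Real.sinh s * Real.exp (-T))) ^ 2 := by nlinarith
  have hS := Real.sinh_pos_iff.2 h0
  have h1 := (pow_le_pow_iff_left₀ dist_nonneg (by positivity) two_ne_zero).1 hsq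
  refine h1.trans ?_
  rw [sub_eq_add_neg, Real.exp_add, ← mul_assoc]
  refine mul_le_mul_of_nonneg_right ?_ (Real.exp_pos _).le
  rw [Real.sinh_eq]
  linarith [Real.exp_pos (-s)]

/-! ### `CAT(-1)` spaces -/

section CAT

variable {X : Type*} [MetricSpace X]

/-- Two geodesics issuing from a common point of a `CAT(-1)` space separate exponentially slowly
before their Gromov product. -/
lemma IsCATNegOne.dist_le_exp (hX : IsCATNegOne X) {x y z : X} {p q : ℝ → X}
    (hp : IsGeodesicSegment x y p) (hq : IsGeodesicSegment x z q) {s : ℝ} (h0 : 0 ≤ s)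
    (hsy : s ≤ dist x y) (hsz : s ≤ dist x z) :
    dist (p s) (q s) ≤ Real.exp (s - gromovProduct y z x) := by
  obtain ⟨x', y', z', p', q', e1, e2, e3, hp', hq', h⟩ := hX.2 x y z p q hp hq
  have := dist_le_exp_upperHalfPlane hp' hq' h0 (e1 ▸ hsy) (e3 ▸ hsz)
  unfold gromovProduct at this ⊢
  rw [e1, e2, e3] at this
  exact (h s ⟨h0, hsy⟩ s ⟨h0, hsz⟩).trans this

/-- A `CAT(-1)` space is Gromov hyperbolic. -/
lemma IsCATNegOne.min_gromovProduct_le (hX : IsCATNegOne X) (x y z o : X) :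
    min (gromovProduct x y o) (gromovProduct y z o) ≤ gromovProduct x z o + 1 := by
  obtain ⟨p, hp⟩ := hX.1 o x
  obtain ⟨q, hq⟩ := hX.1 o y
  obtain ⟨r, hr⟩ := hX.1 o z
  -- At time `t` consecutive geodesics from `o` are at most `1` apart, so `p t` and `r t` are at
  -- most `2` apart; this costs `1` in the Gromov product.
  set t := min (gromovProduct x y o) (gromovProduct y z o) with ht
  have ht0 : 0 ≤ t := le_min (gromovProduct_nonneg _ _ _) (gromovProduct_nonneg _ _ _)
  have h1 : t ≤ gromovProduct x y o := min_le_left _ _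
  have h2 : t ≤ gromovProduct y z o := min_le_right _ _
  have hx := h1.trans (gromovProduct_le_left x y o)
  have hy := h1.trans (gromovProduct_le_right x y o)
  have hz := h2.trans (gromovProduct_le_right y z o)
  have d1 := hX.dist_le_exp hp hq ht0 hx hy
  have d2 := hX.dist_le_exp hq hr ht0 hy hz
  have f1 : Real.exp (t - gromovProduct x y o) ≤ 1 := Real.exp_le_one_iff.2 (by linarith)
  have f2 : Real.exp (t - gromovProduct y z o) ≤ 1 := Real.exp_le_one_iff.2 (by linarith)
  have g1 := hp.dist_right ⟨ht0, hx⟩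
  have g2 := hr.dist_right ⟨ht0, hz⟩
  have t1 := dist_triangle4 x (p t) (r t) z
  have t2 := dist_triangle (p t) (q t) (r t)
  rw [dist_comm x (p t)] at t1
  unfold gromovProduct
  linarith

/-- The distance difference `d(a, p) - d(a, q)` is determined, up to an exponentially small error,
by the point of `[p, a]` at distance `s` from `p`. -/
lemma IsCATNegOne.dist_add_le_of_geodesic (hX : IsCATNegOne X) {a p q : X} {γ : ℝ → X} {L s : ℝ}
    (hγ : IsGeodesicSegment p a γ) (hL : dist p q ≤ L) (hLs : L ≤ s) (hs : s ≤ dist p a) :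
    dist (γ s) q + (dist p a - s) ≤ dist a q + Real.exp (L - s) := by
  have hL0 : 0 ≤ L := dist_nonneg.trans hL
  -- Seen from `a`, the geodesics to `p` and `q` have Gromov product at least `dist p a - L`, so at
  -- distance `dist p a - s` from `a` they are within `exp (L - s)`.
  have hrev : IsGeodesicSegment a p (fun t => γ (dist p a - t)) := by
    refine ⟨by simpa using hγ.2.1, by simpa [dist_comm a p] using hγ.1, fun u hu v hv => ?_⟩
    rw [dist_comm a p] at hu hv
    rw [hγ.2.2 _ ⟨by linarith [hu.2], by linarith [hu.1]⟩ _ ⟨by linarith [hv.2], by linarith [hv.1]⟩,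
      abs_sub_comm]
    congr 1
    ring
  obtain ⟨η, hη⟩ := hX.1 a q
  have h1 : dist p a - s ≤ dist a q := by
    linarith [dist_triangle_right p a q]
  have h0 : 0 ≤ dist p a - s := by linarith
  have h2 : dist p a - s ≤ dist a p := by rw [dist_comm a p]; linarith
  have d1 := hX.dist_le_exp hrev hη h0 h2 h1
  simp only [sub_sub_cancel] at d1
  have d2 := hη.dist_right ⟨h0, h1⟩
  have d3 := dist_triangle (γ s) (η (dist p a - s)) q
  have d4 : Real.exp (dist p a - s - gromovProduct p q a) ≤ Real.exp (L - s) := by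
    refine Real.exp_le_exp.2 ?_
    unfold gromovProduct
    rw [dist_comm a p]
    linarith [dist_triangle_right p a q]
  linarith

/-- Exponential decay of cross differences. -/
lemma IsCATNegOne.abs_cross_difference_le (hX : IsCATNegOne X) {a b p q : X} {L T : ℝ}
    (hL : dist p q ≤ L) (hT : T ≤ gromovProduct a b p) :
    |dist a p - dist a q - dist b p + dist b q| ≤
      (2 * L + 2) * Real.exp L * Real.exp (-T / 2) := by
  have hL0 : 0 ≤ L := dist_nonneg.trans hL
  have hT' : Real.exp (-gromovProduct a b p / 2) ≤ Real.exp (-T / 2) :=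
    Real.exp_le_exp.2 (by linarith)
  refine le_trans ?_ (mul_le_mul_of_nonneg_left hT' (by positivity))
  clear hT hT'
  -- Halving balances two errors: the points at time `s` on `[p, a]` and `[p, b]` are within `exp
  -- (-s)`, and replacing `a` and `b` by them costs `exp (L - s)` each. If `s < L` the trivial bound
  -- `2 * L` suffices.
  set s := gromovProduct a b p / 2 with hs
  have hs0 : 0 ≤ s := by have := gromovProduct_nonneg a b p; positivity
  rw [show -gromovProduct a b p / 2 = -s by rw [hs]; ring, mul_assoc, ← Real.exp_add]
  rcases lt_or_ge s L with h | h
  · have h1 : 1 ≤ Real.exp (L + -s) := Real.one_le_exp (by linarith)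
    have h2 : |dist a p - dist a q| ≤ L :=
      (by simpa only [dist_comm] using abs_dist_sub_le p q a : _ ≤ dist p q).trans hL
    have h3 : |dist b p - dist b q| ≤ L :=
      (by simpa only [dist_comm] using abs_dist_sub_le p q b : _ ≤ dist p q).trans hL
    rw [abs_le] at *
    constructor <;> nlinarith
  · obtain ⟨α, hα⟩ := hX.1 p a
    obtain ⟨β, hβ⟩ := hX.1 p b
    have ha : s ≤ dist p a := by linarith [gromovProduct_le_left a b p]
    have hb : s ≤ dist p b := by linarith [gromovProduct_le_right a b p]
    have d0 := hX.dist_le_exp hα hβ hs0 ha hb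
    rw [show s - gromovProduct a b p = -s by rw [hs]; ring] at d0
    have d1 := hX.dist_add_le_of_geodesic hα hL h ha
    have d2 := hX.dist_add_le_of_geodesic hβ hL h hb
    have t1 := dist_triangle a (α s) q
    have t2 := dist_triangle b (β s) q
    have e1 := hα.dist_right ⟨hs0, ha⟩
    have e2 := hβ.dist_right ⟨hs0, hb⟩
    have t3 := dist_triangle (α s) (β s) q
    have t4 := dist_triangle_left (β s) q (α s)
    have hexp : Real.exp (-s) ≤ Real.exp (L + -s) := Real.exp_le_exp.2 (by linarith)
    rw [← sub_eq_add_neg] at hexp ⊢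
    rw [dist_comm a (α s)] at t1
    rw [dist_comm b (β s)] at t2
    rw [dist_comm a p, dist_comm b p, abs_le]
    have hLE : 0 ≤ L * Real.exp (L - s) := by positivity
    constructor <;> nlinarith

end CAT

/-! ### Stability of quasi-geodesics -/

section Morse

variable {X : Type*} [MetricSpace X]

/-- A chain of `N ≤ 2 ^ k` steps loses at most `k` in the Gromov product. -/
lemma IsCATNegOne.le_gromovProduct_chain (hX : IsCATNegOne X) (f : ℕ → X) (z : X) {r : ℝ} (k : ℕ) :
    ∀ a N : ℕ, 1 ≤ N → N ≤ 2 ^ k →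
      (∀ i, a ≤ i → i < a + N → r ≤ gromovProduct (f i) (f (i + 1)) z) →
        r ≤ gromovProduct (f a) (f (a + N)) z + k := by
  induction k with
  | zero =>
    intro a N h1 h2 h
    obtain rfl : N = 1 := by simp at h2; omega
    simpa using h a le_rfl (by omega)
  | succ k ih =>
    intro a N h1 h2 h
    push_cast
    rw [pow_succ] at h2
    rcases le_or_gt N (2 ^ k) with hN | hN
    · linarith [ih a N h1 hN h]
    · have i1 := ih a (2 ^ k) Nat.one_le_two_pow le_rfl fun i hi hi' => h i hi (by omega)
      have i2 := ih (a + 2 ^ k) (N - 2 ^ k) (by omega) (by omega)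
        fun i hi hi' => h i (by omega) (by omega)
      rw [show a + 2 ^ k + (N - 2 ^ k) = a + N by omega] at i2
      have := hX.min_gromovProduct_le (f a) (f (a + 2 ^ k)) (f (a + N)) z
      rcases min_le_iff.1 this with h | h <;> linarith

lemma sub_le_gromovProduct (z a b : X) : dist z a - dist a b ≤ gromovProduct a b z := by
  have := dist_triangle_right z a b
  unfold gromovProduct
  linarith

/-- Seen from `z`, neighbouring points have product at least `D - L`, and binary subdivision loses
only the logarithm of the number of steps. Thus a short path cannot go around a large ball. -/
lemma IsCATNegOne.le_gromovProduct_of_coarse_path (hX : IsCATNegOne X) {y : ℕ → X} {z : X}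
    {D L : ℝ} {m k i j : ℕ} (hL0 : 0 ≤ L) (hL : ∀ i < m, dist (y i) (y (i + 1)) ≤ L)
    (hD : ∀ i ≤ m, D ≤ dist z (y i)) (hi : i ≤ m) (hj : j ≤ m) (hij : i ≤ j)
    (hk : j - i ≤ 2 ^ k) : D - L ≤ gromovProduct (y i) (y j) z + k := by
  rcases hij.eq_or_lt with rfl | hij
  · have : gromovProduct (y i) (y i) z = dist z (y i) := by
      unfold gromovProduct; rw [dist_self]; ring
    rw [this]
    have := hD i hi
    have : (0 : ℝ) ≤ k := k.cast_nonneg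
    linarith
  · have := hX.le_gromovProduct_chain y z (r := D - L) k i (j - i) (by omega) hk ?_
    · rwa [show i + (j - i) = j by omega] at this
    · intro l h1 h2
      linarith [sub_le_gromovProduct z (y l) (y (l + 1)), hL l (by omega), hD l (by omega)]

/-- Chooses the subdivision depth `k` for the Morse argument: deep enough for a quasi-geodesic piece
with endpoints `6 * D` apart, yet losing so little that `D - L - k` still exceeds `2`. -/
lemma exists_linear_le_two_pow (c b L : ℝ) (hc : 0 < c) :
    ∃ M : ℝ, ∀ D : ℝ, M ≤ D → ∃ k : ℕ, (k : ℝ) + 2 + L < D ∧ 6 * D + b ≤ c * 2 ^ k := by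
  have h1 : Filter.Tendsto (fun k : ℕ => (k : ℝ) / 2 ^ k) Filter.atTop (nhds 0) := by
    simpa using tendsto_pow_const_div_const_pow_of_one_lt 1 (one_lt_two : (1 : ℝ) < 2)
  have h2 : Filter.Tendsto (fun k : ℕ => (1 : ℝ) / 2 ^ k) Filter.atTop (nhds 0) := by
    simpa using tendsto_pow_const_div_const_pow_of_one_lt 0 (one_lt_two : (1 : ℝ) < 2)
  set L' := ⌈L⌉₊ with hL'
  have h3 := (h1.const_mul 6).add (h2.const_mul (6 * (L' + 4) + b))
  rw [mul_zero, mul_zero, add_zero] at h3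
  obtain ⟨K, hK⟩ := Filter.eventually_atTop.1 (h3.eventually_le_const hc)
  refine ⟨K + L' + 4, fun D hD => ?_⟩
  have hD0 : 0 ≤ D := by
    have : (0 : ℝ) ≤ K + L' + 4 := by positivity
    linarith
  have hfl := Nat.floor_le hD0
  have hlt := Nat.lt_floor_add_one D
  have hle : K + L' + 4 ≤ ⌊D⌋₊ := Nat.le_floor (by push_cast; exact hD)
  -- This gives `k + 2 + L < D < k + L' + 4`; the upper bound explains the constant in `h3`.
  obtain ⟨k, hk⟩ : ∃ k, ⌊D⌋₊ = k + L' + 3 := ⟨⌊D⌋₊ - L' - 3, by omega⟩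
  rw [hk] at hfl hlt
  push_cast at hfl hlt
  refine ⟨k, by linarith [Nat.le_ceil L], ?_⟩
  have := hK k (by omega)
  have hpos : (0 : ℝ) < 2 ^ k := by positivity
  rw [mul_div_assoc', mul_div_assoc', ← add_div, div_le_iff₀ hpos] at this
  linarith

/-- Geodesics stay close to quasi-geodesics with the same endpoints. -/
lemma IsCATNegOne.exists_dist_quasigeodesic_le (hX : IsCATNegOne X) (c b L : ℝ) (hc : 0 < c)
    (hL0 : 0 ≤ L) : ∃ M : ℝ, 0 ≤ M ∧ ∀ (y : ℕ → X) (m : ℕ),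
      (∀ i < m, dist (y i) (y (i + 1)) ≤ L) →
      (∀ i j, i ≤ j → j ≤ m → c * (j - i : ℕ) ≤ dist (y i) (y j) + b) →
      ∀ γ : ℝ → X, IsGeodesicSegment (y 0) (y m) γ → ∀ t ∈ Set.Icc 0 (dist (y 0) (y m)),
        ∃ i ≤ m, dist (γ t) (y i) ≤ M := by
  obtain ⟨M, hM⟩ := exists_linear_le_two_pow c b L hc
  refine ⟨max M 0, le_max_right _ _, fun y m hL hy γ hγ t ht => ?_⟩
  set ℓ := dist (y 0) (y m) with hℓ
  set A : Set X := y '' Set.Iic m with hA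
  have hAc : IsCompact A := ((Set.finite_Iic m).image y).isCompact
  have hAn : A.Nonempty := ⟨y 0, 0, Nat.zero_le _, rfl⟩
  have hnear : ∀ x : X, ∃ i ≤ m, dist x (y i) = Metric.infDist x A := fun x => by
    obtain ⟨_, ⟨i, hi, rfl⟩, h⟩ := hAc.exists_infDist_eq_dist hAn x
    exact ⟨i, hi, h.symm⟩
  have hfar : ∀ x : X, ∀ i ≤ m, Metric.infDist x A ≤ dist x (y i) := fun x i hi =>
    Metric.infDist_le_dist_of_mem ⟨i, hi, rfl⟩
  have hcont : ContinuousOn γ (Set.Icc 0 ℓ) := by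
    refine (LipschitzOnWith.of_dist_le_mul (K := 1) fun s hs u hu => ?_).continuousOn
    rw [hγ.2.2 s hs u hu, Real.dist_eq]
    simp
  -- The worst point of the geodesic. Walking `2 * D` to either side, or to an endpoint, and
  -- crossing to the path there gives a detour that avoids the ball of radius `D` about `γ t₀`.
  obtain ⟨t₀, ht₀, hmax⟩ := isCompact_Icc.exists_isMaxOn ⟨t, ht⟩
    ((Metric.continuous_infDist_pt A).comp_continuousOn hcont)
  set D := Metric.infDist (γ t₀) A with hD
  have hmax' : ∀ u ∈ Set.Icc 0 ℓ, Metric.infDist (γ u) A ≤ D := fun u hu => hmax hu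
  have hD0 : 0 ≤ D := Metric.infDist_nonneg
  suffices hDM : D ≤ M by
    obtain ⟨i, hi, h⟩ := hnear (γ t)
    exact ⟨i, hi, h.le.trans ((hmax' t ht).trans (hDM.trans (le_max_left _ _)))⟩
  by_contra hcon
  obtain ⟨k, hk1, hk2⟩ := hM D (not_le.1 hcon).le
  -- A point on each side of `γ t₀`, together with a nearby point of the path.
  obtain ⟨u, hu, hu0, i, hi, hui, hpi⟩ : ∃ u ∈ Set.Icc 0 ℓ, u ∈ Set.Icc (t₀ - 2 * D) t₀ ∧
      ∃ i ≤ m, dist (γ u) (y i) ≤ D ∧ D ≤ gromovProduct (γ u) (y i) (γ t₀) := by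
    rcases le_total (2 * D) t₀ with h | h
    · have hmem : t₀ - 2 * D ∈ Set.Icc 0 ℓ := ⟨by linarith, by linarith [ht₀.2]⟩
      obtain ⟨i, hi, hd⟩ := hnear (γ (t₀ - 2 * D))
      have h1 := hmax' _ hmem
      refine ⟨_, hmem, ⟨le_rfl, by linarith⟩, i, hi, by linarith, ?_⟩
      have h2 := sub_le_gromovProduct (γ t₀) (γ (t₀ - 2 * D)) (y i)
      rw [hγ.2.2 _ ht₀ _ hmem, sub_sub_cancel, abs_of_nonneg (by linarith)] at h2
      linarith
    · refine ⟨0, ⟨le_rfl, dist_nonneg⟩, ⟨by linarith, ht₀.1⟩, 0, Nat.zero_le _, ?_, ?_⟩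
      · rw [hγ.1, dist_self]; exact hD0
      · have h2 := sub_le_gromovProduct (γ t₀) (γ 0) (y 0)
        have h3 := hfar (γ t₀) 0 (Nat.zero_le _)
        rw [hγ.1, dist_self] at h2
        rw [hγ.1]
        linarith
  obtain ⟨v, hv, hv0, j, hj, hvj, hpj⟩ : ∃ v ∈ Set.Icc 0 ℓ, v ∈ Set.Icc t₀ (t₀ + 2 * D) ∧
      ∃ j ≤ m, dist (γ v) (y j) ≤ D ∧ D ≤ gromovProduct (γ v) (y j) (γ t₀) := by
    rcases le_total (t₀ + 2 * D) ℓ with h | h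
    · have hmem : t₀ + 2 * D ∈ Set.Icc 0 ℓ := ⟨by linarith [ht₀.1], h⟩
      obtain ⟨i, hi, hd⟩ := hnear (γ (t₀ + 2 * D))
      have h1 := hmax' _ hmem
      refine ⟨_, hmem, ⟨by linarith, le_rfl⟩, i, hi, by linarith, ?_⟩
      have h2 := sub_le_gromovProduct (γ t₀) (γ (t₀ + 2 * D)) (y i)
      rw [hγ.2.2 _ ht₀ _ hmem, abs_sub_comm, add_sub_cancel_left, abs_of_nonneg (by linarith)] at h2
      linarith
    · refine ⟨ℓ, ⟨dist_nonneg, le_rfl⟩, ⟨ht₀.2, h⟩, m, le_rfl, ?_, ?_⟩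
      · rw [hγ.2.1, dist_self]; exact hD0
      · have h2 := sub_le_gromovProduct (γ t₀) (γ ℓ) (y m)
        have h3 := hfar (γ t₀) m le_rfl
        rw [hγ.2.1, dist_self] at h2
        rw [hγ.2.1]
        linarith
  have hzero : gromovProduct (γ u) (γ v) (γ t₀) = 0 := by
    unfold gromovProduct
    rw [hγ.2.2 _ ht₀ _ hu, hγ.2.2 _ ht₀ _ hv, hγ.2.2 _ hu _ hv,
      abs_of_nonneg (sub_nonneg.2 hu0.2), abs_of_nonpos (sub_nonpos.2 hv0.1),
      abs_of_nonpos (by linarith [hu0.2, hv0.1])]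
    ring
  have huv : dist (γ u) (γ v) ≤ 4 * D := by
    rw [hγ.2.2 _ hu _ hv, abs_of_nonpos (by linarith [hu0.2, hv0.1])]
    linarith [hu0.1, hv0.2]
  have hyij : dist (y i) (y j) ≤ 6 * D := by
    have := dist_triangle4 (y i) (γ u) (γ v) (y j)
    rw [dist_comm (y i) (γ u)] at this
    linarith
  have hpow : ∀ {N : ℕ}, c * N ≤ 6 * D + b → N ≤ 2 ^ k := fun {N} h => by
    have : c * (N : ℝ) ≤ c * 2 ^ k := h.trans hk2
    exact_mod_cast le_of_mul_le_mul_left this hc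
  have hmid : D - L ≤ gromovProduct (y i) (y j) (γ t₀) + k := by
    rcases le_total i j with hij | hij
    · exact hX.le_gromovProduct_of_coarse_path hL0 hL (hfar _) hi hj hij
        (hpow (by linarith [hy i j hij hj]))
    · rw [gromovProduct_comm]
      rw [dist_comm] at hyij
      exact hX.le_gromovProduct_of_coarse_path hL0 hL (hfar _) hj hi hij
        (hpow (by linarith [hy j i hij hi]))
  -- Two uses of hyperbolicity cost `2`. All three products along the detour exceed `2`, while the
  -- product of `γ u` and `γ v` is `0`.
  have f1 := hX.min_gromovProduct_le (γ u) (y i) (y j) (γ t₀)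
  have f2 := hX.min_gromovProduct_le (γ u) (y j) (γ v) (γ t₀)
  rw [gromovProduct_comm (y j) (γ v), hzero] at f2
  have hk0 : (0 : ℝ) ≤ k := k.cast_nonneg
  rcases min_le_iff.1 f1 with f1 | f1 <;> rcases min_le_iff.1 f2 with f2 | f2 <;> linarith

end Morse

/-! ### Word length -/

section Words

variable {Γ : Type*} [Group Γ] {n : ℕ} {gen : Fin n → Γ}

lemma wordEval_append (w w' : List (Fin n)) :
    wordEval gen (w ++ w') = wordEval gen w * wordEval gen w' := by
  simp [wordEval]

lemma wordLength_wordEval_le (w : List (Fin n)) : wordLength gen (wordEval gen w) ≤ w.length :=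
  Nat.sInf_le ⟨w, rfl, rfl⟩

lemma IsSymmetricGenerating.exists_word (hgen : IsSymmetricGenerating gen) (h : Γ) :
    ∃ w : List (Fin n), wordEval gen w = h := by
  have hmem : h ∈ Subgroup.closure (Set.range gen) := hgen.2.2 ▸ Subgroup.mem_top h
  induction hmem using Subgroup.closure_induction with
  | mem x hx =>
    obtain ⟨i, rfl⟩ := hx
    exact ⟨[i], by simp [wordEval]⟩
  | one => exact ⟨[], by simp [wordEval]⟩
  | mul x y _ _ hx hy =>
    obtain ⟨w, rfl⟩ := hx
    obtain ⟨w', rfl⟩ := hy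
    exact ⟨w ++ w', wordEval_append w w'⟩
  | inv x hmem hx =>
    obtain ⟨w, rfl⟩ := hx
    clear h hmem
    induction w with
    | nil => exact ⟨[], by simp [wordEval]⟩
    | cons i w ih =>
      obtain ⟨w', hw'⟩ := ih
      obtain ⟨j, hj⟩ := hgen.2.1 i
      refine ⟨w' ++ [j], ?_⟩
      rw [wordEval_append, hw', show wordEval gen [j] = (gen i)⁻¹ by simp [wordEval, hj],
        show wordEval gen (i :: w) = gen i * wordEval gen w by simp [wordEval], mul_inv_rev]

lemma IsSymmetricGenerating.exists_geodesic_word (hgen : IsSymmetricGenerating gen) (h : Γ) :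
    ∃ w : List (Fin n), w.length = wordLength gen h ∧ wordEval gen w = h :=
  Nat.sInf_mem (s := {k | ∃ w : List (Fin n), w.length = k ∧ wordEval gen w = h})
    ((hgen.exists_word h).elim fun w hw => ⟨w.length, w, rfl, hw⟩)

lemma IsSymmetricGenerating.wordLength_mul_le (hgen : IsSymmetricGenerating gen) (a b : Γ) :
    wordLength gen (a * b) ≤ wordLength gen a + wordLength gen b := by
  obtain ⟨w, hw, rfl⟩ := hgen.exists_geodesic_word a
  obtain ⟨w', hw', rfl⟩ := hgen.exists_geodesic_word b
  rw [← hw, ← hw', ← wordEval_append, ← List.length_append]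
  exact wordLength_wordEval_le _

/-- A subword of a geodesic word is at least as long as its length. -/
lemma IsGeodesicWord.sub_le_wordLength (hgen : IsSymmetricGenerating gen) {w : List (Fin n)}
    (hw : IsGeodesicWord gen w) {i j : ℕ} (hij : i ≤ j) (hj : j ≤ w.length) :
    j - i ≤ wordLength gen ((wordEval gen (w.take i))⁻¹ * wordEval gen (w.take j)) := by
  have h1 : wordEval gen w = wordEval gen (w.take i) *
      ((wordEval gen (w.take i))⁻¹ * wordEval gen (w.take j)) * wordEval gen (w.drop j) := by
    rw [mul_inv_cancel_left, ← wordEval_append, List.take_append_drop]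
  have h2 := hgen.wordLength_mul_le (wordEval gen (w.take i) *
      ((wordEval gen (w.take i))⁻¹ * wordEval gen (w.take j))) (wordEval gen (w.drop j))
  rw [← h1, ← hw] at h2
  have h3 := hgen.wordLength_mul_le (wordEval gen (w.take i))
      ((wordEval gen (w.take i))⁻¹ * wordEval gen (w.take j))
  have h4 := wordLength_wordEval_le (gen := gen) (w.take i)
  have h5 := wordLength_wordEval_le (gen := gen) (w.drop j)
  rw [List.length_take] at h4
  rw [List.length_drop] at h5
  omega

end Words

/-! ### Orbits -/

section Orbits

variable {Γ X : Type*} [Group Γ] [MetricSpace X] [MulAction Γ X]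

lemma finite_dist_smul_le [ProperSpace X] [ProperlyDiscontinuousSMul Γ X] (x₀ : X) (Q : ℝ) :
    {h : Γ | dist (h • x₀) x₀ ≤ Q}.Finite := by
  refine (ProperlyDiscontinuousSMul.finite_disjoint_inter_image (Γ := Γ)
    (isCompact_singleton (x := x₀)) (isCompact_closedBall x₀ Q)).subset fun h hh => ?_
  change (((h • ·) '' {x₀}) ∩ Metric.closedBall x₀ Q).Nonempty
  exact ⟨h • x₀, ⟨x₀, rfl, rfl⟩, hh⟩

variable [IsIsometricSMul Γ X]

lemma dist_smul_smul_eq (a b : Γ) (x y : X) : dist (a • x) (b • y) = dist ((b⁻¹ * a) • x) y := by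
  rw [← dist_smul b⁻¹ (a • x) (b • y), inv_smul_smul, mul_smul]

/-- Orbit maps of convex cocompact actions do not contract the word metric too much. -/
lemma IsConvexCocompact.exists_wordLength_le [ProperSpace X] [ProperlyDiscontinuousSMul Γ X]
    (hX : IsGeodesicSpace X) (hcc : IsConvexCocompact Γ X) {n : ℕ} {gen : Fin n → Γ}
    (hgen : IsSymmetricGenerating gen) (x₀ : X) :
    ∃ c b : ℝ, 0 < c ∧ ∀ h : Γ, c * wordLength gen h ≤ dist (h • x₀) x₀ + b := by
  obtain ⟨C, ⟨c₀, hc₀⟩, hinv, ⟨R, hR⟩, K, -, hK, hCK⟩ := hcc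
  obtain ⟨S, hS⟩ := hK.isBounded.subset_closedBall c₀
  have hnear : ∀ x ∈ C, ∃ h : Γ, dist x (h • c₀) ≤ S := fun x hx => by
    obtain ⟨h, k, hk, rfl⟩ := Set.mem_iUnion.1 (hCK hx)
    exact ⟨h, by simpa using hS hk⟩
  -- The Švarc–Milnor argument: orbit points within `R + S` of geodesic points at unit spacing
  -- differ by elements of this finite set, whose word lengths are at most `M`.
  have hfin := finite_dist_smul_le (Γ := Γ) c₀ (2 * (R + S) + 1)
  obtain ⟨M, hM⟩ := (hfin.image (wordLength gen)).bddAbove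
  have hM' : ∀ h : Γ, dist (h • c₀) c₀ ≤ 2 * (R + S) + 1 → wordLength gen h ≤ M := fun h hh =>
    hM ⟨h, hh, rfl⟩
  have hlen : ∀ h : Γ, (wordLength gen h : ℝ) ≤ (M + 1) * (dist (h • c₀) c₀ + 3) := by
    intro h
    have hhc : h • c₀ ∈ C := by rw [← hinv h]; exact Set.smul_mem_smul_set hc₀
    obtain ⟨γ, hγ⟩ := hX c₀ (h • c₀)
    set ℓ := dist c₀ (h • c₀) with hℓ
    have hclose : ∀ t ∈ Set.Icc 0 ℓ, ∃ h' : Γ, dist (γ t) (h' • c₀) ≤ R + S := fun t ht => by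
      obtain ⟨x, hx, hd⟩ := hR c₀ hc₀ (h • c₀) hhc γ hγ t ht
      obtain ⟨h', hh'⟩ := hnear x hx
      exact ⟨h', (dist_triangle _ x _).trans (add_le_add hd hh')⟩
    have hRS : 0 ≤ R + S := by
      obtain ⟨h', hh'⟩ := hclose 0 ⟨le_rfl, dist_nonneg⟩
      exact dist_nonneg.trans hh'
    choose! e he using hclose
    have hstep : ∀ i : ℕ, (i : ℝ) ≤ ℓ → wordLength gen (e i) ≤ M * (i + 1) := by
      intro i
      induction i with
      | zero =>
        intro hi
        rw [Nat.cast_zero] at hi ⊢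
        have h0 := he 0 ⟨le_rfl, hi⟩
        rw [hγ.1, dist_comm] at h0
        simpa using hM' (e 0) (by linarith)
      | succ i ih =>
        intro hi
        have hi' : (i : ℝ) ≤ ℓ := by push_cast at hi; linarith
        have m1 : (i : ℝ) ∈ Set.Icc 0 ℓ := ⟨i.cast_nonneg, hi'⟩
        have m2 : ((i + 1 : ℕ) : ℝ) ∈ Set.Icc 0 ℓ := ⟨Nat.cast_nonneg _, hi⟩
        have h1 := he _ m1
        have h2 := he _ m2
        have h3 : dist (γ (i + 1 : ℕ)) (γ i) = 1 := by
          rw [hγ.2.2 _ m2 _ m1]; push_cast; simp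
        have h4 := dist_triangle4 (e (i + 1 : ℕ) • c₀) (γ (i + 1 : ℕ)) (γ i) (e i • c₀)
        rw [dist_smul_smul_eq, dist_comm (e (i + 1 : ℕ) • c₀) (γ (i + 1 : ℕ))] at h4
        have h5 := hM' _ (h4.trans (by linarith))
        have h6 := hgen.wordLength_mul_le (e i) ((e i)⁻¹ * e (i + 1 : ℕ))
        rw [mul_inv_cancel_left] at h6
        have := ih hi'
        rw [mul_add, mul_one]
        omega
    have hfl := Nat.floor_le (show 0 ≤ ℓ from dist_nonneg)
    have hlt := Nat.lt_floor_add_one ℓ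
    set N := ⌊ℓ⌋₊ with hN
    have mN : (N : ℝ) ∈ Set.Icc 0 ℓ := ⟨N.cast_nonneg, hfl⟩
    have h1 := he _ mN
    have h2 := hγ.dist_right mN
    have h4 := dist_triangle_left (h • c₀) (e N • c₀) (γ N)
    rw [dist_smul_smul_eq] at h4
    have h5 := hM' _ (h4.trans (by linarith))
    have h6 := hgen.wordLength_mul_le (e N) ((e N)⁻¹ * h)
    rw [mul_inv_cancel_left] at h6
    have h7 := hstep N hfl
    have h8 : wordLength gen h ≤ M * (N + 1) + M := by omega
    have h9 : (wordLength gen h : ℝ) ≤ M * (N + 1) + M := by exact_mod_cast h8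
    rw [dist_comm (h • c₀) c₀, ← hℓ]
    have hM0 : (0 : ℝ) ≤ M := M.cast_nonneg
    nlinarith
  refine ⟨1 / (M + 1), 3 + 2 * dist x₀ c₀, by positivity, fun h => ?_⟩
  have h1 := hlen h
  have h2 := dist_triangle4 (h • c₀) (h • x₀) x₀ c₀
  rw [dist_smul, dist_comm c₀ x₀] at h2
  have hpos : (0 : ℝ) < M + 1 := by positivity
  rw [one_div, inv_mul_le_iff₀ hpos]
  nlinarith

/-- Along geodesic words whose prefixes conjugate `g` to pairwise distinct elements, the Gromov
product of the endpoint of the word and its `g`-translate is bounded. -/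
lemma exists_gromovProduct_smul_le [ProperSpace X] [ProperlyDiscontinuousSMul Γ X]
    (hX : IsCATNegOne X) {n : ℕ} {gen : Fin n → Γ} (hgen : IsSymmetricGenerating gen) (g : Γ)
    (x₀ : X) {c b L : ℝ} (hc : 0 < c)
    (hlow : ∀ h : Γ, c * wordLength gen h ≤ dist (h • x₀) x₀ + b) (hL0 : 0 ≤ L)
    (hL : ∀ i, dist (gen i • x₀) x₀ ≤ L) :
    ∃ B : ℝ, ∀ w : List (Fin n), IsGeodesicWord gen w →
      (∀ i ≤ w.length, ∀ j ≤ w.length,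
        (wordEval gen (w.take i))⁻¹ * g * wordEval gen (w.take i) =
          (wordEval gen (w.take j))⁻¹ * g * wordEval gen (w.take j) → i = j) →
      gromovProduct (wordEval gen w • x₀) (g • wordEval gen w • x₀) x₀ ≤ B := by
  obtain ⟨D, hD0, hD⟩ := hX.exists_dist_quasigeodesic_le c b L hc hL0
  set D₀ := dist (g • x₀) x₀ with hD₀
  have hD₀0 : 0 ≤ D₀ := dist_nonneg
  -- `3 * D₀ + 4` bounds how far `g` moves the geodesic before time `T`; passing to a path point
  -- within `D` adds `2 * D`.
  have hfin := finite_dist_smul_le (Γ := Γ) x₀ (3 * D₀ + 4 + 2 * D)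
  set F := hfin.toFinset with hF
  refine ⟨(2 * D + 1) * F.card, fun w hw hinj => ?_⟩
  by_contra! hlt
  set y : ℕ → X := fun i => wordEval gen (w.take i) • x₀ with hy
  have hy0 : y 0 = x₀ := by simp [hy, wordEval]
  have hym : y w.length = wordEval gen w • x₀ := by simp [hy]
  rw [← hym] at hlt
  obtain ⟨γ, hγ⟩ := hX.1 (y 0) (y w.length)
  have hDγ := hD y w.length (fun i hi => by
      rw [dist_comm]
      simp only [hy]
      rw [List.take_add_one, List.getElem?_eq_getElem hi, wordEval_append, dist_smul_smul_eq,
        inv_mul_cancel_left]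
      simpa [wordEval] using hL _) (fun i j hij hj => by
      rw [dist_comm]
      simp only [hy]
      rw [dist_smul_smul_eq]
      refine le_trans ?_ (hlow _)
      refine mul_le_mul_of_nonneg_left ?_ hc.le
      exact_mod_cast hw.sub_le_wordLength hgen hij hj) γ hγ
  set T := gromovProduct (y w.length) (g • y w.length) x₀ with hT
  have hTle : T ≤ dist (y 0) (y w.length) := hy0 ▸ gromovProduct_le_left _ _ _
  -- Points of the geodesic before the Gromov product are moved a bounded amount by `g`.
  have hmove : ∀ s, 0 ≤ s → s ≤ T → dist (g • γ s) (γ s) ≤ 3 * D₀ + 4 := by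
    intro s hs0 hsT
    have hs : s ∈ Set.Icc 0 (dist (y 0) (y w.length)) := ⟨hs0, hsT.trans hTle⟩
    have e1 := hγ.dist_left hs
    have e2 := hγ.dist_right hs
    rw [hy0] at e1 e2
    have f1 : gromovProduct (γ s) (y w.length) x₀ = s := by
      unfold gromovProduct; linarith
    have t1 := dist_triangle x₀ (g • x₀) (g • γ s)
    have t1' := dist_triangle_left (g • x₀) (g • γ s) x₀
    have t2 := dist_triangle_left (g • x₀) (g • y w.length) x₀
    rw [dist_smul] at t1 t1' t2
    rw [dist_comm x₀ (g • x₀)] at t1 t1' t2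
    have f2 : s - D₀ ≤ gromovProduct (g • y w.length) (g • γ s) x₀ := by
      unfold gromovProduct
      rw [dist_smul, dist_comm (y w.length) (γ s)]
      linarith
    -- Hyperbolicity along `γ s`, `y w.length`, `g • y w.length`, `g • γ s` makes the product of the
    -- two outer points at least `s - D₀ - 2`.
    have g1 := hX.min_gromovProduct_le (γ s) (y w.length) (g • y w.length) x₀
    rw [f1, min_eq_left hsT] at g1
    have g2 := hX.min_gromovProduct_le (γ s) (g • y w.length) (g • γ s) x₀
    have g3 : s - D₀ - 2 ≤ gromovProduct (γ s) (g • γ s) x₀ := by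
      rcases min_le_iff.1 g2 with h | h <;> linarith
    unfold gromovProduct at g3
    rw [dist_comm (γ s)] at g3
    linarith
  -- Sample points spaced by `2 * D + 1` cannot share a path point within `D`; `F.card + 1` of them
  -- fit before `T`, enough for the pigeonhole.
  have hs : ∀ k : ℕ, k ≤ F.card → (0 : ℝ) ≤ (2 * D + 1) * k ∧ (2 * D + 1) * (k : ℝ) ≤ T := by
    intro k hk
    refine ⟨by positivity, le_trans ?_ hlt.le⟩
    have : (k : ℝ) ≤ F.card := by exact_mod_cast hk
    exact mul_le_mul_of_nonneg_left this (by positivity)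
  have hidx : ∀ k : ℕ, k ≤ F.card →
      ∃ i ≤ w.length, dist (γ ((2 * D + 1) * k)) (y i) ≤ D := fun k hk =>
    hDγ _ ⟨(hs k hk).1, (hs k hk).2.trans hTle⟩
  choose! ι hι1 hι2 using hidx
  obtain ⟨k, hk, k', hk', hne, heq⟩ := Finset.exists_ne_map_eq_of_card_lt_of_maps_to
    (s := Finset.range (F.card + 1)) (t := F)
    (f := fun k => (wordEval gen (w.take (ι k)))⁻¹ * g * wordEval gen (w.take (ι k))) (by simp)
    (fun k hk => by
      have hk' : k ≤ F.card := by simpa [Nat.lt_succ_iff] using hk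
      simp only [hF, Set.Finite.coe_toFinset, Set.mem_ofPred_eq]
      rw [mul_assoc, ← dist_smul_smul_eq, mul_smul]
      have h1 := hι2 k hk'
      have h2 := hmove _ (hs k hk').1 (hs k hk').2
      have h3 := dist_triangle4 (g • y (ι k)) (g • γ ((2 * D + 1) * k)) (γ ((2 * D + 1) * k))
        (y (ι k))
      rw [dist_smul, dist_comm (y (ι k))] at h3
      exact h3.trans (by linarith))
  have hk1 : k ≤ F.card := by simpa [Nat.lt_succ_iff] using hk
  have hk1' : k' ≤ F.card := by simpa [Nat.lt_succ_iff] using hk'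
  have hιeq := hinj _ (hι1 k hk1) _ (hι1 k' hk1') heq
  have h1 := hι2 k hk1
  have h2 := hι2 k' hk1'
  rw [← hιeq] at h2
  have h3 := dist_triangle_right (γ ((2 * D + 1) * k)) (γ ((2 * D + 1) * k')) (y (ι k))
  rw [hγ.2.2 _ ⟨(hs k hk1).1, (hs k hk1).2.trans hTle⟩ _
    ⟨(hs k' hk1').1, (hs k' hk1').2.trans hTle⟩, ← mul_sub, abs_mul,
    abs_of_nonneg (by positivity)] at h3
  have h4 : (1 : ℝ) ≤ |(k : ℝ) - k'| := by
    have : (1 : ℤ) ≤ |(k : ℤ) - k'| := Int.one_le_abs (sub_ne_zero.2 (by exact_mod_cast hne))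
    exact_mod_cast this
  nlinarith

end Orbits

/-! ### Paths of a coding -/

namespace LabelledGraph

variable {V : Type*} {n : ℕ} {G : LabelledGraph V n}

lemma labelWord_take : ∀ (x : List V) (h : G.IsWalk x) (k : ℕ) (h' : G.IsWalk (x.take (k + 1))),
    G.labelWord (x.take (k + 1)) h' = (G.labelWord x h).take k
  | [], _, _, _ => by simp [labelWord]
  | [_], _, _, _ => by simp [labelWord]
  | _ :: b :: l, h, 0, _ => by simp [labelWord]
  | a :: b :: l, h, k + 1, h' => by
    have ih := labelWord_take (b :: l) (List.isChain_cons_cons.1 h).2 k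
      (List.isChain_cons_cons.1 h').2
    simp only [List.take_succ_cons] at ih ⊢
    simp [labelWord, ih]

lemma length_labelWord : ∀ (x : List V) (h : G.IsWalk x), (G.labelWord x h).length = x.length - 1
  | [], _ => rfl
  | [_], _ => rfl
  | _ :: b :: l, h => by
    simp [labelWord, length_labelWord (b :: l) (List.isChain_cons_cons.1 h).2]

lemma Path.length_pos (x : G.Path) : 0 < x.length := by
  obtain ⟨l, h, -⟩ := x
  cases l with
  | nil => simp at h
  | cons a l => exact Nat.succ_pos _

lemma Path.length_word (x : G.Path) : x.word.length + 1 = x.length := by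
  have := x.length_pos
  unfold Path.word
  rw [length_labelWord]
  unfold Path.length at *
  omega

/-- The path formed by the first `k + 1` vertices of a path. -/
def Path.initial (x : G.Path) (k : ℕ) : G.Path :=
  ⟨x.1.take (k + 1), by
    obtain ⟨l, h, -⟩ := x
    cases l with
    | nil => simp at h
    | cons a l => simpa using h, x.2.2.take (k + 1)⟩

lemma Path.word_initial (x : G.Path) (k : ℕ) : (x.initial k).word = x.word.take k :=
  labelWord_take x.1 x.2.2 k _

lemma Path.word_eq_take_of_mem_extensions {u x : G.Path} (h : x ∈ u.extensions) :
    u.word = x.word.take u.word.length := by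
  have h1 : u = x.initial u.word.length := by
    apply Subtype.ext
    have h2 := List.prefix_iff_eq_take.1 h
    change u.1 = x.1.take (u.word.length + 1)
    rw [u.length_word]
    exact h2
  have h3 := congrArg Path.word h1
  rwa [Path.word_initial] at h3

variable {Γ : Type*} [Group Γ] {gen : Fin n → Γ} {g : Γ}

/-- The prefixes of the word of a path conjugate `g` to pairwise distinct elements. -/
lemma IsRedfernCoding.take_injective (hG : G.IsRedfernCoding gen (Subgroup.centralizer {g}))
    (x : G.Path) {i j : ℕ} (hi : i ≤ x.word.length) (hj : j ≤ x.word.length)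
    (h : (wordEval gen (x.word.take i))⁻¹ * g * wordEval gen (x.word.take i) =
      (wordEval gen (x.word.take j))⁻¹ * g * wordEval gen (x.word.take j)) : i = j := by
  -- Equal conjugates mean that `b * a⁻¹` commutes with `g`, so the two prefixes represent the same
  -- coset.
  have hp : x.initial i = x.initial j := by
    apply hG.bijective.1
    apply Quotient.sound
    change QuotientGroup.rightRel _ _ _
    rw [QuotientGroup.rightRel_apply, Subgroup.mem_centralizer_singleton_iff]
    unfold Path.elt
    rw [Path.word_initial, Path.word_initial]
    generalize wordEval gen (x.word.take i) = a at *
    generalize wordEval gen (x.word.take j) = b at *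
    have : b * (a⁻¹ * g * a) * a⁻¹ = b * (b⁻¹ * g * b) * a⁻¹ := by rw [h]
    simpa [mul_assoc] using this
  have := congrArg (fun y : G.Path => y.word.length) hp
  simpa [Path.word_initial, hi, hj] using this

end LabelledGraph

/-! ### Variation of the excess -/

section Displacement

variable {Γ X V : Type*} [Group Γ] [MetricSpace X] [MulAction Γ X] [IsIsometricSMul Γ X]

/-- The correction term of a path is its excess `d(p, g p) - 2 d(p, x₀)`. -/
lemma tau_eq {n : ℕ} {G : LabelledGraph V n} (gen : Fin n → Γ) (x₀ : X) (g : Γ) (u : G.Path) :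
    tau gen x₀ g u =
      dist (u.elt gen • x₀) (g • u.elt gen • x₀) - 2 * dist (u.elt gen • x₀) x₀ := by
  unfold tau gromovProduct
  rw [mul_smul, dist_smul, dist_comm x₀ (g • x₀), dist_comm x₀ (u.elt gen • x₀)]
  ring

/-- The excess `d(p, g p) - 2 d(p, x₀)` changes by an exponentially small amount under bounded
moves of `p`, as long as the Gromov product of `p` and `g p` stays bounded. -/
lemma IsCATNegOne.abs_excess_sub_le (hX : IsCATNegOne X) (g : Γ) (x₀ : X) {p q : X} {B L : ℝ}
    (hL : dist p q ≤ L) (hp : gromovProduct p (g • p) x₀ ≤ B)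
    (hq : gromovProduct q (g • q) x₀ ≤ B) :
    |dist p (g • p) - 2 * dist p x₀ - (dist q (g • q) - 2 * dist q x₀)| ≤
      2 * ((2 * L + 2) * Real.exp L *
        Real.exp (-(dist q x₀ - L - B - dist (g • x₀) x₀) / 2)) := by
  have hL0 : 0 ≤ L := dist_nonneg.trans hL
  have hqL : dist (g • q) (g • p) ≤ L := by rwa [dist_smul, dist_comm]
  have hD₀ : 0 ≤ dist (g • x₀) x₀ := dist_nonneg
  have s1 : dist (g • p) (g • x₀) = dist p x₀ := dist_smul g p x₀
  have s2 : dist (g • q) (g • x₀) = dist q x₀ := dist_smul g q x₀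
  have t1 := dist_triangle_left q x₀ p
  have t2 := dist_triangle_right (g • q) (g • x₀) x₀
  have t3 := dist_triangle_right q (g • x₀) x₀
  unfold gromovProduct at hp hq
  rw [dist_comm x₀ p, dist_comm x₀ (g • p)] at hp
  rw [dist_comm x₀ q, dist_comm x₀ (g • q)] at hq
  -- The difference is telescoped through `d(q, g p)`: first `p` is moved to `q`, then `g p` to `g
  -- q`. The Gromov product for the first move equals `d(p, x₀) - ⟨p, g p⟩`.
  have e1 := hX.abs_cross_difference_le (a := g • p) (b := x₀) hL
    (T := dist q x₀ - L - B - dist (g • x₀) x₀) (by unfold gromovProduct; linarith)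
  have e2 := hX.abs_cross_difference_le (a := q) (b := g • x₀) hqL
    (T := dist q x₀ - L - B - dist (g • x₀) x₀) (by
      unfold gromovProduct
      rw [dist_comm (g • q) q]
      linarith)
  rw [dist_comm (g • p) p, dist_comm (g • p) q, dist_comm x₀ p, dist_comm x₀ q] at e1
  rw [dist_comm (g • x₀) (g • q), dist_comm (g • x₀) (g • p), s1, s2] at e2
  rw [abs_le] at e1 e2 ⊢
  constructor <;> linarith

end Displacement

/-- Summation of geometrically small increments. -/
lemma abs_sub_le_of_geometric_increments {f : ℕ → ℝ} {K ρ : ℝ} {m : ℕ} (hK : 0 ≤ K) (hρ0 : 0 < ρ)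
    (hρ1 : ρ < 1) (h : ∀ j < m, |f (j + 1) - f j| ≤ K * ρ ^ j) {k : ℕ} (hk : k ≤ m) :
    |f m - f k| ≤ K / (1 - ρ) * ρ ^ k := by
  have h1 : 0 < 1 - ρ := by linarith
  -- Keeping the exact finite geometric sum lets the induction on `m` close.
  suffices H : |f m - f k| ≤ K / (1 - ρ) * (ρ ^ k - ρ ^ m) by
    refine H.trans (mul_le_mul_of_nonneg_left ?_ (by positivity))
    linarith [pow_pos hρ0 m]
  induction m, hk using Nat.le_induction with
  | base => simp
  | succ m hk ih =>
    have i1 := ih fun j hj => h j (by omega)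
    have i2 := h m (by omega)
    have e : K / (1 - ρ) * (ρ ^ k - ρ ^ (m + 1)) =
        K / (1 - ρ) * (ρ ^ k - ρ ^ m) + K * ρ ^ m := by
      field_simp
      ring
    rw [e, show f (m + 1) - f k = (f m - f k) + (f (m + 1) - f m) by ring]
    exact (abs_add_le _ _).trans (add_le_add i1 i2)

end RedfernCoding

/-! ### Assembly -/

theorem mainTheorem3 {Γ X V : Type*} [Group Γ] [MetricSpace X] [ProperSpace X] [MulAction Γ X]
    [IsIsometricSMul Γ X] [ProperlyDiscontinuousSMul Γ X] [Finite V]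
    (hX : RedfernCoding.IsCATNegOne X) (hΓ : RedfernCoding.IsWordHyperbolic Γ)
    (hcc : RedfernCoding.IsConvexCocompact Γ X)
    {n : ℕ} (gen : Fin n → Γ) (hgen : RedfernCoding.IsSymmetricGenerating gen)
    (g : Γ) (G : RedfernCoding.LabelledGraph V n)
    (hG : G.IsRedfernCoding gen (Subgroup.centralizer {g})) (x₀ : X) :
    ∃ K ρ : ℝ, 0 < K ∧ 0 < ρ ∧ ρ < 1 ∧
      (∃ M : ℝ, ∀ u : G.Path, |RedfernCoding.tau gen x₀ g u| ≤ M) ∧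
      ∀ (l : ℕ) (u : G.Path), u.length = l → ∀ x ∈ u.extensions,
        |dist (((x.elt gen)⁻¹ * g * x.elt gen) • x₀) x₀
            - 2 * RedfernCoding.displacement gen x₀ x - RedfernCoding.tau gen x₀ g u| ≤ K * ρ ^ l := by
  open RedfernCoding in
  obtain ⟨c, b, hc, hlow⟩ := hcc.exists_wordLength_le hX.1 hgen x₀
  obtain ⟨L, hL0, hL⟩ : ∃ L : ℝ, 0 ≤ L ∧ ∀ i, dist (gen i • x₀) x₀ ≤ L := by
    obtain ⟨L, hL⟩ := (Set.finite_range fun i => dist (gen i • x₀) x₀).bddAbove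
    exact ⟨max L 0, le_max_right _ _, fun i => (hL ⟨i, rfl⟩).trans (le_max_left _ _)⟩
  obtain ⟨B, hB⟩ := exists_gromovProduct_smul_le hX hgen g x₀ hc hlow hL0 hL
  have hBx : ∀ x : G.Path, gromovProduct (x.elt gen • x₀) (g • x.elt gen • x₀) x₀ ≤ B :=
    fun x => hB x.word (hG.geodesic x) fun i hi j hj => hG.take_injective x hi hj
  set D₀ := dist (g • x₀) x₀ with hD₀
  -- `c` is the growth rate of the orbit along geodesic words; the `2` comes from the exponent in
  -- the cross-difference estimate.
  set ρ := Real.exp (-c / 2) with hρ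
  have hρ0 : 0 < ρ := Real.exp_pos _
  have hρ1 : ρ < 1 := Real.exp_lt_one_iff.2 (by linarith)
  set K := 2 * ((2 * L + 2) * Real.exp L * Real.exp ((b + L + B + D₀) / 2)) with hK
  have hK0 : 0 < K := by positivity
  have h1ρ : 0 < 1 - ρ := by linarith
  -- The extra division by `ρ` is needed because `|u|` counts vertices, one more than the letters of
  -- `u`. The bound on `τ` comes from `F p = d(g p, x₀) - d(p, x₀) - 2 ⟨p, g p⟩`.
  refine ⟨K / (1 - ρ) / ρ, ρ, by positivity, hρ0, hρ1, ⟨D₀ + 2 * B, fun u => ?_⟩, ?_⟩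
  · rw [tau_eq]
    have h1 := hBx u
    have h2 := gromovProduct_nonneg (u.elt gen • x₀) (g • u.elt gen • x₀) x₀
    have s1 : dist (g • u.elt gen • x₀) (g • x₀) = dist (u.elt gen • x₀) x₀ := dist_smul _ _ _
    have t1 := dist_triangle_right (g • u.elt gen • x₀) (g • x₀) x₀
    have t2 := dist_triangle (g • u.elt gen • x₀) (g • x₀) x₀
    unfold gromovProduct at h1 h2
    rw [dist_comm x₀ (u.elt gen • x₀), dist_comm x₀ (g • u.elt gen • x₀)] at h1 h2
    rw [abs_le]
    constructor <;> linarith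
  · rintro l u rfl x hx
    have hux := LabelledGraph.Path.word_eq_take_of_mem_extensions hx
    set y : ℕ → X := fun j => wordEval gen (x.word.take j) • x₀ with hy
    have hyB : ∀ j, gromovProduct (y j) (g • y j) x₀ ≤ B := fun j => by
      have := hBx (x.initial j)
      rwa [LabelledGraph.Path.elt, LabelledGraph.Path.word_initial] at this
    set f : ℕ → ℝ := fun j => dist (y j) (g • y j) - 2 * dist (y j) x₀ with hf
    have hstep : ∀ j < x.word.length, |f (j + 1) - f j| ≤ K * ρ ^ j := fun j hj => by
      have hd : dist (y (j + 1)) (y j) ≤ L := by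
        simp only [hy]
        rw [List.take_add_one, List.getElem?_eq_getElem hj, wordEval_append, dist_smul_smul_eq,
          inv_mul_cancel_left]
        simpa [wordEval] using hL _
      refine (hX.abs_excess_sub_le g x₀ hd (hyB _) (hyB _)).trans ?_
      have hgeo : c * j ≤ dist (y j) x₀ + b := by
        refine le_trans ?_ (hlow _)
        refine mul_le_mul_of_nonneg_left ?_ hc.le
        have := (hG.geodesic x).sub_le_wordLength hgen (Nat.zero_le j) hj.le
        simp only [List.take_zero, Nat.sub_zero] at this
        rw [show wordEval gen [] = 1 from rfl, inv_one, one_mul] at this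
        exact_mod_cast this
      have hexp : Real.exp (-(dist (y j) x₀ - L - B - D₀) / 2) ≤
          Real.exp ((b + L + B + D₀) / 2) * ρ ^ j := by
        rw [hρ, ← Real.exp_nat_mul, ← Real.exp_add]
        refine Real.exp_le_exp.2 ?_
        linarith
      calc 2 * ((2 * L + 2) * Real.exp L * Real.exp (-(dist (y j) x₀ - L - B - D₀) / 2))
          ≤ 2 * ((2 * L + 2) * Real.exp L * (Real.exp ((b + L + B + D₀) / 2) * ρ ^ j)) := by
            gcongr
        _ = K * ρ ^ j := by rw [hK]; ring
    have hle : u.word.length ≤ x.word.length := by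
      have := congrArg List.length hux
      rw [List.length_take] at this
      omega
    have hmain := abs_sub_le_of_geometric_increments hK0.le hρ0 hρ1 hstep hle
    have hfx : dist (((x.elt gen)⁻¹ * g * x.elt gen) • x₀) x₀ - 2 * displacement gen x₀ x =
        f x.word.length := by
      rw [mul_assoc, ← dist_smul_smul_eq, mul_smul, dist_comm]
      simp [hf, hy, displacement, LabelledGraph.Path.elt]
    have hfu : tau gen x₀ g u = f u.word.length := by
      rw [tau_eq]
      simp only [hf, hy]
      rw [← hux]
      rfl
    rw [hfx, hfu, ← u.length_word, pow_succ]
    refine hmain.trans (le_of_eq ?_)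
    field_simp
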